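/- \textbf{Setting.} Formulas are built from propositional variables with the connectives $\land,\lor,\to,\sim$, and $\phi\leftrightarrow\psi$ abbreviates $(\phi\to\psi)\land(\psi\to\phi)$. The \emph{theorems} of Nelson logic (constructive logic with strong negation) are the formulas derivable by modus ponens (from $\phi$ and $\phi\to\psi$ infer $\psi$) from all instances of the axiom schemes \begin{itemize} \item $\phi\to(\psi\to\phi)$; \item $(\phi\to(\psi\to\gamma))\to((\phi\to\psi)\to(\phi\to\gamma))$; \item $(\phi\land\psi)\to\phi$; $\ (\phi\land\psi)\to\psi$; $\ (\phi\to\psi)\to((\phi\to\gamma)\to(\phi\to(\psi\land\gamma)))$; \item $\phi\to(\phi\lor\psi)$; $\ \psi\to(\phi\lor\psi)$; $\ (\phi\to\gamma)\to((\psi\to\gamma)\to((\phi\lor\psi)\to\gamma))$; \item $\sim\sim\phi\leftrightarrow\phi$; $\ \sim(\phi\lor\psi)\leftrightarrow(\sim\phi\land\sim\psi)$; $\ \sim(\phi\land\psi)\leftrightarrow(\sim\phi\lor\sim\psi)$; $\ \sim(\phi\to\psi)\leftrightarrow(\phi\land\sim\psi)$; \item $\phi\to(\sim\phi\to\psi)$.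 \end{itemize} Let $\lesssim$ be a quasiorder (a reflexive and transitive relation) on a set $U$, and let $[x)=\{y\in U: x\lesssim y\}$. For $X\subseteq U$ put $$X^{\blacktriangledown}=\{x\in U:[x)\subseteq X\},\qquad X^{\blacktriangle}=\{x\in U:[x)\cap X\neq\emptyset\}.$$ Let $RS=\{(X^{\blacktriangledown},X^{\blacktriangle}):X\subseteq U\}$, ordered by coordinatewise inclusion. It is a bounded distributive lattice whose joins and meets are the coordinatewise unions and intersections, with least element $(\emptyset,\emptyset)$ and greatest element $(U,U)$, and it is a Nelson algebra with the operations $$\sim(A,B)=(B^c,A^c),\qquad (A,B)\to(C,D)=\big((A^c\cup C)^{\blacktriangledown},\,A^c\cup D\big).$$ This is the \emph{rough set-based Nelson algebra determined by $\lesssim$}. A formula is \emph{valid} in it if its value is $(U,U)$ under every assignment of elements of $RS$ to the variables. \textbf{Theorem.} For every formula $\alpha$ of Nelson logic the following are equivalent: \begin{enumerate} \item[(a)] $\alpha$ is a theorem of Nelson logic; \item[(b)] $\alpha$ is valid in every finite rough set-based Nelson algebra determined by a quasiorder. \end{enumerate} -/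

import Mathlib

universe u w

namespace NelsonLogic

/-- Formulas over a set `V` of propositional variables, in the language `∧, ∨, →, ∼`. -/
inductive Formula (V : Type u) : Type u
  | var : V → Formula V
  | and : Formula V → Formula V → Formula V
  | or : Formula V → Formula V → Formula V
  | imp : Formula V → Formula V → Formula V
  | neg : Formula V → Formula V

/-- The weak equivalence `φ ↔ ψ := (φ → ψ) ∧ (ψ → φ)`. -/
def Formula.iff {V : Type u} (φ ψ : Formula V) : Formula V :=
  (φ.imp ψ).and (ψ.imp φ)

/-- The theorems of Nelson's constructive logic with strong negation: the Hilbert calculus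
with the axiom schemes of positive intuitionistic logic, the axiom schemes for the strong
negation, the explosion axiom scheme, and modus ponens as the only rule. -/
inductive Provable {V : Type u} : Formula V → Prop
  | a1 (φ ψ : Formula V) : Provable (φ.imp (ψ.imp φ))
  | a2 (φ ψ γ : Formula V) :
      Provable ((φ.imp (ψ.imp γ)).imp ((φ.imp ψ).imp (φ.imp γ)))
  | a3 (φ ψ : Formula V) : Provable ((φ.and ψ).imp φ)
  | a4 (φ ψ : Formula V) : Provable ((φ.and ψ).imp ψ)
  | a5 (φ ψ γ : Formula V) :
      Provable ((φ.imp ψ).imp ((φ.imp γ).imp (φ.imp (ψ.and γ))))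
  | a6 (φ ψ : Formula V) : Provable (φ.imp (φ.or ψ))
  | a7 (φ ψ : Formula V) : Provable (ψ.imp (φ.or ψ))
  | a8 (φ ψ γ : Formula V) :
      Provable ((φ.imp γ).imp ((ψ.imp γ).imp ((φ.or ψ).imp γ)))
  | a9 (φ : Formula V) : Provable (φ.neg.neg.iff φ)
  | a10 (φ ψ : Formula V) : Provable ((φ.or ψ).neg.iff (φ.neg.and ψ.neg))
  | a11 (φ ψ : Formula V) : Provable ((φ.and ψ).neg.iff (φ.neg.or ψ.neg))
  | a12 (φ ψ : Formula V) : Provable ((φ.imp ψ).neg.iff (φ.and ψ.neg))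
  | a13 (φ ψ : Formula V) : Provable (φ.imp (φ.neg.imp ψ))
  | mp {φ ψ : Formula V} : Provable φ → Provable (φ.imp ψ) → Provable ψ

/-- Nelson algebras: Kleene algebras with a weak implication. -/
class NelsonAlgebra (A : Type u) extends DistribLattice A, BoundedOrder A where
  /-- strong negation -/
  neg : A → A
  /-- weak implication -/
  imp : A → A → A
  neg_neg : ∀ x, neg (neg x) = x
  neg_inf : ∀ x y, neg (x ⊓ y) = neg x ⊔ neg y
  kleene : ∀ x y, x ⊓ neg x ≤ y ⊔ neg y
  imp_self : ∀ x, imp x x = ⊤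
  neg_sup_le_imp : ∀ x y, neg x ⊔ y ≤ imp x y
  inf_neg_sup : ∀ x y, x ⊓ (neg x ⊔ y) = x ⊓ imp x y
  imp_inf : ∀ x y z, imp x (y ⊓ z) = imp x y ⊓ imp x z
  imp_imp : ∀ x y z, imp x (imp y z) = imp (x ⊓ y) z

/-- The value of a formula in a Nelson algebra under a valuation of the variables. -/
def Formula.eval {V : Type u} {A : Type w} [NelsonAlgebra A] (v : V → A) : Formula V → A
  | .var p => v p
  | .and φ ψ => φ.eval v ⊓ ψ.eval v
  | .or φ ψ => φ.eval v ⊔ ψ.eval v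
  | .imp φ ψ => NelsonAlgebra.imp (φ.eval v) (ψ.eval v)
  | .neg φ => NelsonAlgebra.neg (φ.eval v)

/-- A formula is valid in a Nelson algebra if it has value `1` under every valuation. -/
def Formula.Valid {V : Type u} (φ : Formula V) (A : Type w) [NelsonAlgebra A] : Prop :=
  ∀ v : V → A, φ.eval v = ⊤

section Rough

variable {U : Type u} [Preorder U]

/-- The lower approximation of `X` with respect to the quasiorder `≤`. -/
def lower (X : Set U) : Set U := {x | Set.Ici x ⊆ X}

/-- The upper approximation of `X` with respect to the quasiorder `≤`. -/
def upper (X : Set U) : Set U := {x | (Set.Ici x ∩ X).Nonempty}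

/-- The set `RS(≤)` of the rough sets `(lower X, upper X)` induced by the quasiorder. -/
def RoughSet (U : Type u) [Preorder U] : Type u :=
  {p : Set U × Set U // ∃ X : Set U, p = (lower X, upper X)}

theorem mem_lower {X : Set U} {x : U} : x ∈ lower X ↔ ∀ y, x ≤ y → y ∈ X := Iff.rfl

theorem mem_upper {X : Set U} {x : U} : x ∈ upper X ↔ ∃ y, x ≤ y ∧ y ∈ X := Iff.rfl

/-- An up-set in which every element has a second successor contains a set `C` such that every
element has a successor in `C` and one outside `C`. -/
theorem exists_cofinal_split (E : Set U) (hE : IsUpperSet E)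
    (h2 : ∀ x ∈ E, ∃ y, x ≤ y ∧ y ≠ x) :
    ∃ C ⊆ E, ∀ x ∈ E, (∃ y, x ≤ y ∧ y ∈ C) ∧ ∃ y, x ≤ y ∧ y ∉ C := by
  classical
  -- pairs of disjoint subsets of `E`, each of which has successors in the other
  let G : Set (Set U × Set U) := {p | p.1 ⊆ E ∧ p.2 ⊆ E ∧ Disjoint p.1 p.2 ∧
    (∀ x ∈ p.1, ∃ y, x ≤ y ∧ y ∈ p.2) ∧ (∀ x ∈ p.2, ∃ y, x ≤ y ∧ y ∈ p.1)}
  obtain ⟨M, hM⟩ : ∃ M, Maximal (· ∈ G) M := by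
    refine zorn_le₀ G fun c hc hch => ?_
    refine ⟨(⋃ p ∈ c, p.1, ⋃ p ∈ c, p.2), ⟨?_, ?_, ?_, ?_, ?_⟩, fun p hp => ⟨?_, ?_⟩⟩
    · exact Set.iUnion₂_subset fun p hp => (hc hp).1
    · exact Set.iUnion₂_subset fun p hp => (hc hp).2.1
    · rw [Set.disjoint_left]
      intro x hx hx'
      simp only [Set.mem_iUnion, exists_prop] at hx hx'
      obtain ⟨p, hp, hxp⟩ := hx
      obtain ⟨q, hq, hxq⟩ := hx'
      rcases hch.total hp hq with h | h
      · exact Set.disjoint_left.1 (hc hq).2.2.1 (h.1 hxp) hxq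
      · exact Set.disjoint_left.1 (hc hp).2.2.1 hxp (h.2 hxq)
    · intro x hx
      simp only [Set.mem_iUnion, exists_prop] at hx ⊢
      obtain ⟨p, hp, hxp⟩ := hx
      obtain ⟨y, hy, hyp⟩ := (hc hp).2.2.2.1 x hxp
      exact ⟨y, hy, p, hp, hyp⟩
    · intro x hx
      simp only [Set.mem_iUnion, exists_prop] at hx ⊢
      obtain ⟨p, hp, hxp⟩ := hx
      obtain ⟨y, hy, hyp⟩ := (hc hp).2.2.2.2 x hxp
      exact ⟨y, hy, p, hp, hyp⟩
    · exact Set.subset_biUnion_of_mem (u := fun p : Set U × Set U => p.1) hp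
    · exact Set.subset_biUnion_of_mem (u := fun p : Set U × Set U => p.2) hp
  obtain ⟨⟨P, Q⟩, ⟨hP, hQ, hPQ, hPs, hQs⟩, hmax⟩ : ∃ M, Maximal (· ∈ G) M := ⟨M, hM⟩
  simp only at hP hQ hPQ hPs hQs
  -- it is impossible to extend the pair above an element without successors in it
  have ext : ∀ P' Q' : Set U, P'.Nonempty → P' ⊆ E → Q' ⊆ E → Disjoint P' Q' →
      (∀ x ∈ P', ∃ y, x ≤ y ∧ y ∈ Q') → (∀ x ∈ Q', ∃ y, x ≤ y ∧ y ∈ P') →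
      (∀ x, x ∈ P' ∨ x ∈ Q' → x ∉ P ∧ x ∉ Q) → False := by
    intro P' Q' hne h1 h2 h3 h4 h5 h6
    have hG : (P ∪ P', Q ∪ Q') ∈ G := by
      refine ⟨Set.union_subset hP h1, Set.union_subset hQ h2, ?_, ?_, ?_⟩
      · rw [Set.disjoint_left] at *
        rintro x (hx | hx) (hx' | hx')
        · exact hPQ hx hx'
        · exact (h6 x (Or.inr hx')).1 hx
        · exact (h6 x (Or.inl hx)).2 hx'
        · exact h3 hx hx'
      · rintro x (hx | hx)
        · obtain ⟨y, hy, hy'⟩ := hPs x hx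
          exact ⟨y, hy, Or.inl hy'⟩
        · obtain ⟨y, hy, hy'⟩ := h4 x hx
          exact ⟨y, hy, Or.inr hy'⟩
      · rintro x (hx | hx)
        · obtain ⟨y, hy, hy'⟩ := hQs x hx
          exact ⟨y, hy, Or.inl hy'⟩
        · obtain ⟨y, hy, hy'⟩ := h5 x hx
          exact ⟨y, hy, Or.inr hy'⟩
    have hle := hmax hG ⟨Set.subset_union_left, Set.subset_union_left⟩
    obtain ⟨x, hx⟩ := hne
    exact (h6 x (Or.inl hx)).1 (hle.1 (Or.inr hx))
  have key : ∀ w ∈ E, ∃ y, w ≤ y ∧ (y ∈ P ∨ y ∈ Q) := by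
    by_contra! hcon
    obtain ⟨w, hwE, hw⟩ := hcon
    by_cases hcl : ∃ a b, w ≤ a ∧ a ≤ b ∧ b ≤ a ∧ b ≠ a
    · obtain ⟨a, b, hwa, hab, hba, hne⟩ := hcl
      have haE := hE hwa hwE
      refine ext {a} {b} ⟨a, rfl⟩ (by simpa using haE) (by simpa using hE hab haE)
        (by simpa using hne.symm) (by simpa using hab) (by simpa using hba) ?_
      rintro x (rfl | rfl)
      · exact hw _ hwa
      · exact hw _ (hwa.trans hab)
    · push Not at hcl
      have step : ∀ x : {x // w ≤ x}, ∃ y : {x // w ≤ x}, x.1 < y.1 := by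
        rintro ⟨x, hx⟩
        obtain ⟨y, hxy, hne⟩ := h2 x (hE hx hwE)
        refine ⟨⟨y, hx.trans hxy⟩, lt_of_le_not_ge hxy fun hyx => ?_⟩
        exact hne (hcl x y hx hxy hyx)
      choose s hs using step
      let f : ℕ → {x // w ≤ x} := fun n => s^[n] ⟨w, le_rfl⟩
      have hf : StrictMono fun n => (f n).1 := strictMono_nat_of_lt_succ fun n => by
        simp only [f, Function.iterate_succ_apply']
        exact hs _
      refine ext {x | ∃ n, (f (2 * n)).1 = x} {x | ∃ n, (f (2 * n + 1)).1 = x}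
        ⟨_, 0, rfl⟩ ?_ ?_ ?_ ?_ ?_ ?_
      · rintro _ ⟨n, rfl⟩
        exact hE (f _).2 hwE
      · rintro _ ⟨n, rfl⟩
        exact hE (f _).2 hwE
      · rw [Set.disjoint_left]
        rintro _ ⟨n, rfl⟩ ⟨m, hm⟩
        have hlt : ∀ i j, (f i).1 = (f j).1 → i = j := fun i j hij => by
          rcases lt_trichotomy i j with h | h | h
          · exact absurd hij (hf h).ne
          · exact h
          · exact absurd hij.symm (hf h).ne
        have := hlt _ _ hm
        omega
      · rintro _ ⟨n, rfl⟩
        exact ⟨_, (hf (Nat.lt_succ_self _)).le, n, rfl⟩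
      · rintro _ ⟨n, rfl⟩
        exact ⟨_, (hf (Nat.lt_succ_self _)).le, n + 1, rfl⟩
      · rintro x (⟨n, rfl⟩ | ⟨n, rfl⟩)
        · exact hw _ (f _).2
        · exact hw _ (f _).2
  refine ⟨P, hP, fun x hx => ?_⟩
  obtain ⟨y, hxy, hy | hy⟩ := key x hx
  · obtain ⟨z, hyz, hz⟩ := hPs y hy
    exact ⟨⟨y, hxy, hy⟩, z, hxy.trans hyz, fun h => Set.disjoint_left.1 hPQ h hz⟩
  · obtain ⟨z, hyz, hz⟩ := hQs y hy
    exact ⟨⟨z, hxy.trans hyz, hz⟩, y, hxy, fun h => Set.disjoint_left.1 hPQ h hy⟩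

/-- The pairs `(A, B)` of an up-set and a down-set with `A ⊆ B` which agree on the elements
without further successors. -/
def IsRough (A B : Set U) : Prop :=
  IsUpperSet A ∧ IsLowerSet B ∧ A ⊆ B ∧ ∀ x, Set.Ici x = {x} → x ∈ B → x ∈ A

theorem exists_eq_iff_isRough (A B : Set U) :
    (∃ X : Set U, (A, B) = (lower X, upper X)) ↔ IsRough A B := by
  constructor
  · rintro ⟨X, hX⟩
    obtain ⟨rfl, rfl⟩ := Prod.mk.inj hX
    refine ⟨fun x y hxy hx z hz => hx (hxy.trans hz), ?_, ?_, ?_⟩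
    · rintro x y hyx ⟨z, hz, hzX⟩
      exact ⟨z, hyx.trans hz, hzX⟩
    · exact fun x hx => ⟨x, le_rfl, hx le_rfl⟩
    · rintro x hx ⟨y, hy, hyX⟩
      rw [hx] at hy
      obtain rfl : y = x := hy
      intro z hz
      rw [hx] at hz
      obtain rfl : z = y := hz
      exact hyX
  · rintro ⟨hA, hB, hAB, hS⟩
    let E : Set U := {x | x ∈ B ∧ (∀ y, x ≤ y → y ∉ A) ∧ ∀ y, x ≤ y → y ∈ B}
    have hE : IsUpperSet E := fun x y hxy hx =>
      ⟨hx.2.2 y hxy, fun z hz => hx.2.1 z (hxy.trans hz), fun z hz => hx.2.2 z (hxy.trans hz)⟩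
    obtain ⟨C, hCE, hC⟩ := exists_cofinal_split E hE (fun x hx => by
      by_contra! h
      refine hx.2.1 x le_rfl (hS x ?_ hx.1)
      ext y
      exact ⟨fun hy => h y hy, fun hy => by rw [Set.mem_singleton_iff.1 hy]; exact le_rfl⟩)
    let F : Set U := {x | x ∈ B ∧ (∀ y, x ≤ y → y ∉ A) ∧ ∃ y, x ≤ y ∧ y ∉ B}
    have hXB : A ∪ F ∪ C ⊆ B := by
      rintro x ((hx | hx) | hx)
      exacts [hAB hx, hx.1, (hCE hx).1]
    refine ⟨A ∪ F ∪ C, Prod.ext ?_ ?_⟩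
    · ext x
      refine ⟨fun hx y hy => Or.inl (Or.inl (hA hy hx)), fun hx => ?_⟩
      rcases hx (le_refl x) with (hxA | hxF) | hxC
      · exact hxA
      · obtain ⟨y, hxy, hy⟩ := hxF.2.2
        exact absurd (hXB (hx hxy)) hy
      · obtain ⟨y, hxy, hy⟩ := (hC x (hCE hxC)).2
        have hyE := hE hxy (hCE hxC)
        rcases hx hxy with (hyA | hyF) | hyC
        · exact absurd hyA (hyE.2.1 y le_rfl)
        · obtain ⟨z, hyz, hz⟩ := hyF.2.2
          exact absurd (hyE.2.2 z hyz) hz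
        · exact absurd hyC hy
    · ext x
      refine ⟨fun hx => ?_, ?_⟩
      · by_cases h1 : ∃ y, x ≤ y ∧ y ∈ A
        · obtain ⟨y, hxy, hy⟩ := h1
          exact ⟨y, hxy, Or.inl (Or.inl hy)⟩
        · push Not at h1
          by_cases h2 : ∃ y, x ≤ y ∧ y ∉ B
          · exact ⟨x, le_rfl, Or.inl (Or.inr ⟨hx, h1, h2⟩)⟩
          · push Not at h2
            obtain ⟨y, hxy, hy⟩ := (hC x ⟨hx, h1, h2⟩).1
            exact ⟨y, hxy, Or.inr hy⟩
      · rintro ⟨y, hxy, hy⟩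
        exact hB hxy (hXB hy)

namespace RoughSet

theorem isRough (p : RoughSet U) : IsRough p.1.1 p.1.2 :=
  (exists_eq_iff_isRough _ _).1 p.2

/-- The rough set with given components. -/
def mk (A B : Set U) (h : IsRough A B) : RoughSet U :=
  ⟨(A, B), (exists_eq_iff_isRough A B).2 h⟩

@[ext] theorem ext {p q : RoughSet U} (h1 : p.1.1 = q.1.1) (h2 : p.1.2 = q.1.2) : p = q :=
  Subtype.ext (Prod.ext h1 h2)

/-- The coordinatewise order. -/
instance : PartialOrder (RoughSet U) :=
  inferInstanceAs (PartialOrder {p : Set U × Set U // ∃ X : Set U, p = (lower X, upper X)})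

theorem le_def {p q : RoughSet U} : p ≤ q ↔ p.1.1 ⊆ q.1.1 ∧ p.1.2 ⊆ q.1.2 := Iff.rfl

/-- Joins and meets are coordinatewise unions and intersections. -/
instance : DistribLattice (RoughSet U) where
  sup p q := mk (p.1.1 ∪ q.1.1) (p.1.2 ∪ q.1.2)
    ⟨p.isRough.1.union q.isRough.1, p.isRough.2.1.union q.isRough.2.1,
      Set.union_subset_union p.isRough.2.2.1 q.isRough.2.2.1, fun x hx =>
        Or.imp (p.isRough.2.2.2 x hx) (q.isRough.2.2.2 x hx)⟩
  inf p q := mk (p.1.1 ∩ q.1.1) (p.1.2 ∩ q.1.2)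
    ⟨p.isRough.1.inter q.isRough.1, p.isRough.2.1.inter q.isRough.2.1,
      Set.inter_subset_inter p.isRough.2.2.1 q.isRough.2.2.1, fun x hx =>
        And.imp (p.isRough.2.2.2 x hx) (q.isRough.2.2.2 x hx)⟩
  le_sup_left _ _ := ⟨Set.subset_union_left, Set.subset_union_left⟩
  le_sup_right _ _ := ⟨Set.subset_union_right, Set.subset_union_right⟩
  sup_le _ _ _ h h' := ⟨Set.union_subset h.1 h'.1, Set.union_subset h.2 h'.2⟩
  inf_le_left _ _ := ⟨Set.inter_subset_left, Set.inter_subset_left⟩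
  inf_le_right _ _ := ⟨Set.inter_subset_right, Set.inter_subset_right⟩
  le_inf _ _ _ h h' := ⟨Set.subset_inter h.1 h'.1, Set.subset_inter h.2 h'.2⟩
  le_sup_inf _ _ _ :=
    ⟨(Set.union_inter_distrib_left _ _ _).ge, (Set.union_inter_distrib_left _ _ _).ge⟩

/-- The bounds are `(∅, ∅)` and `(U, U)`. -/
instance : BoundedOrder (RoughSet U) where
  top := mk Set.univ Set.univ
    ⟨isUpperSet_univ, isLowerSet_univ, subset_rfl, fun _ _ h => h⟩
  bot := mk ∅ ∅ ⟨isUpperSet_empty, isLowerSet_empty, subset_rfl, fun _ _ h => h⟩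
  le_top _ := ⟨Set.subset_univ _, Set.subset_univ _⟩
  bot_le _ := ⟨Set.empty_subset _, Set.empty_subset _⟩

/-- The strong negation `∼(A, B) = (Bᶜ, Aᶜ)`. -/
def neg (p : RoughSet U) : RoughSet U :=
  mk p.1.2ᶜ p.1.1ᶜ ⟨p.isRough.2.1.compl, p.isRough.1.compl,
    Set.compl_subset_compl.2 p.isRough.2.2.1, fun x hx h h' => h (p.isRough.2.2.2 x hx h')⟩

/-- The weak implication `(A, B) → (C, D) = (lower (Aᶜ ∪ C), Aᶜ ∪ D)`. -/
def imp (p q : RoughSet U) : RoughSet U :=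
  mk (lower (p.1.1ᶜ ∪ q.1.1)) (p.1.1ᶜ ∪ q.1.2)
    ⟨fun _ _ hxy hx _ hz => hx (hxy.trans hz), p.isRough.1.compl.union q.isRough.2.1,
      fun _ hx => (hx le_rfl).imp id (fun h => q.isRough.2.2.1 h), fun x hx h => by
        change Set.Ici x ⊆ _
        rw [hx, Set.singleton_subset_iff]
        exact h.imp id (q.isRough.2.2.2 x hx)⟩

/-- `∼(lower X, upper X) = (lower Xᶜ, upper Xᶜ)`. -/
theorem neg_eq (X : Set U) :
    (neg ⟨(lower X, upper X), X, rfl⟩ : RoughSet U) = ⟨(lower Xᶜ, upper Xᶜ), Xᶜ, rfl⟩ := by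
  refine RoughSet.ext ?_ ?_
  · ext x
    change x ∉ upper X ↔ x ∈ lower Xᶜ
    simp only [mem_lower, mem_upper, Set.mem_compl_iff]
    push Not
    rfl
  · ext x
    change x ∉ lower X ↔ x ∈ upper Xᶜ
    simp only [mem_lower, mem_upper, Set.mem_compl_iff]
    push Not
    rfl

/-- `p → q` is the relative pseudocomplement of `p` with respect to `∼p ∨ q`. -/
theorem le_imp_iff (p q r : RoughSet U) : r ≤ imp p q ↔ r ⊓ p ≤ neg p ⊔ q := by
  have hp := p.isRough.2.2.1
  constructor
  · rintro ⟨h1, h2⟩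
    refine ⟨fun x hx => ?_, fun x hx => ?_⟩
    · exact Or.inr ((h1 hx.1 le_rfl).resolve_left fun h => h hx.2)
    · exact h2 hx.1
  · rintro ⟨h1, h2⟩
    refine ⟨fun x hx y hy => ?_, fun x hx => ?_⟩
    · by_cases hyp : y ∈ p.1.1
      · exact Or.inr ((h1 ⟨r.isRough.1 hy hx, hyp⟩).resolve_left fun h => h (hp hyp))
      · exact Or.inl hyp
    · by_cases hxp : x ∈ p.1.1
      · exact h2 ⟨hx, hp hxp⟩
      · exact Or.inl hxp

/-- The rough set Nelson algebra determined by a quasiorder. -/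
instance : NelsonAlgebra (RoughSet U) where
  neg := neg
  imp := imp
  neg_neg p := RoughSet.ext (compl_compl _) (compl_compl _)
  neg_inf p q := RoughSet.ext (Set.compl_inter _ _) (Set.compl_inter _ _)
  kleene p q := by
    refine ⟨fun x hx => absurd (p.isRough.2.2.1 hx.1) hx.2, fun x _ => ?_⟩
    by_cases h : x ∈ q.1.1
    · exact Or.inl (q.isRough.2.2.1 h)
    · exact Or.inr h
  imp_self p := top_le_iff.1 ((le_imp_iff _ _ _).2 (inf_le_right.trans le_sup_right))
  neg_sup_le_imp p q := (le_imp_iff _ _ _).2 inf_le_left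
  inf_neg_sup p q := by
    refine le_antisymm (le_inf inf_le_left ?_) (le_inf inf_le_left ?_)
    · exact inf_le_right.trans ((le_imp_iff _ _ _).2 inf_le_left)
    · rw [inf_comm]
      exact (le_imp_iff _ _ _).1 le_rfl
  imp_inf p q r := by
    refine eq_of_forall_le_iff fun s => ?_
    rw [le_inf_iff, le_imp_iff, le_imp_iff, le_imp_iff, sup_inf_left, le_inf_iff]
  imp_imp p q r := by
    refine RoughSet.ext (Set.ext fun x => ⟨fun h y hy => ?_, fun h y hy => ?_⟩) ?_
    · by_cases hyp : y ∈ p.1.1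
      · by_cases hyq : y ∈ q.1.1
        · exact Or.inr (((h hy).resolve_left fun h => h hyp) le_rfl |>.resolve_left
            fun h => h hyq)
        · exact Or.inl fun h => hyq h.2
      · exact Or.inl fun h => hyp h.1
    · by_cases hyp : y ∈ p.1.1
      · refine Or.inr fun z hz => ?_
        rcases h (le_trans hy hz) with h | h
        · exact Or.inl fun hzq => h ⟨p.isRough.1 hz hyp, hzq⟩
        · exact Or.inr h
      · exact Or.inl hyp
    · change p.1.1ᶜ ∪ (q.1.1ᶜ ∪ r.1.2) = (p.1.1 ∩ q.1.1)ᶜ ∪ r.1.2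
      rw [Set.compl_inter, Set.union_assoc]

end RoughSet

end Rough

end NelsonLogic

namespace NelsonLogic

/-! ### Kripke semantics of rough sets, and soundness -/

section Soundness

variable {V : Type u} {U : Type w} [Preorder U]

/-! A rough set `(A, B)` is a three-valued proposition on the quasiorder: verified on the up-set
`A`, falsified on the disjoint up-set `Bᶜ`, undecided elsewhere. Under this reading the algebra
operations become the Kripke clauses of Nelson logic, and soundness (`Provable.verifies`) is a check
of the axioms at each point.

For completeness, a non-theorem is omitted by some prime theory (`exists_isPrimeTheory`). The
canonical model of prime theories is cut down to finitely many points by keeping one theory for each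
trace on the finite set of signed subformulas, and the truth lemma `verifies_falsifies_iff` refutes
the formula there.

The obstacle is that a rough set must be decided at every point which is its own only successor.
Since only a quasiorder is required, each point is given an equivalent twin. No such point remains,
and every disjoint pair of up-sets then comes from a rough set by `exists_eq_iff_isRough`. -/

theorem RoughSet.eq_top_iff {p : RoughSet U} : p = ⊤ ↔ ∀ x, x ∈ p.1.1 := by
  constructor
  · rintro rfl x
    exact Set.mem_univ x
  · exact fun h => top_le_iff.1 ⟨fun x _ => h x, fun x _ => p.isRough.2.2.1 (h x)⟩

/-- `φ` is verified at `x`: `x` lies in the lower component of its value. -/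
def Verifies (v : V → RoughSet U) (x : U) (φ : Formula V) : Prop := x ∈ (φ.eval v).1.1

/-- `φ` is falsified at `x`: `x` lies outside the upper component of its value. -/
def Falsifies (v : V → RoughSet U) (x : U) (φ : Formula V) : Prop := x ∉ (φ.eval v).1.2

variable {v : V → RoughSet U} {x y : U} {φ ψ : Formula V}

theorem Verifies.mono (hxy : x ≤ y) (h : Verifies v x φ) : Verifies v y φ :=
  (φ.eval v).isRough.1 hxy h

theorem Verifies.not_falsifies (h : Verifies v x φ) : ¬ Falsifies v x φ :=
  fun h' => h' ((φ.eval v).isRough.2.2.1 h)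

theorem verifies_and : Verifies v x (φ.and ψ) ↔ Verifies v x φ ∧ Verifies v x ψ := Iff.rfl

theorem verifies_or : Verifies v x (φ.or ψ) ↔ Verifies v x φ ∨ Verifies v x ψ := Iff.rfl

/-- The lower approximation in the first component of `imp` supplies the quantifier over successors,
which gives the intuitionistic clause. -/
theorem verifies_imp :
    Verifies v x (φ.imp ψ) ↔ ∀ y, x ≤ y → Verifies v y φ → Verifies v y ψ := by
  refine forall₂_congr fun y _ => ?_
  change (y ∉ (φ.eval v).1.1 ∨ y ∈ (ψ.eval v).1.1) ↔ _
  exact (imp_iff_not_or).symm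

theorem verifies_neg : Verifies v x φ.neg ↔ Falsifies v x φ := Iff.rfl

theorem falsifies_and : Falsifies v x (φ.and ψ) ↔ Falsifies v x φ ∨ Falsifies v x ψ :=
  not_and_or

theorem falsifies_or : Falsifies v x (φ.or ψ) ↔ Falsifies v x φ ∧ Falsifies v x ψ :=
  not_or

/-- No approximation is taken in the second component of `imp`, so falsification is local to the
point, as axiom `a12` demands. -/
theorem falsifies_imp : Falsifies v x (φ.imp ψ) ↔ Verifies v x φ ∧ Falsifies v x ψ := by
  change ¬ (x ∉ (φ.eval v).1.1 ∨ x ∈ (ψ.eval v).1.2) ↔ _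
  rw [not_or, not_not]
  rfl

theorem falsifies_neg : Falsifies v x φ.neg ↔ Verifies v x φ := not_not

theorem verifies_iff (h : ∀ y, Verifies v y φ ↔ Verifies v y ψ) : Verifies v x (φ.iff ψ) :=
  verifies_and.2 ⟨verifies_imp.2 fun y _ => (h y).1, verifies_imp.2 fun y _ => (h y).2⟩

theorem Provable.verifies (h : Provable φ) (x : U) : Verifies v x φ := by
  induction h generalizing x with
  | a1 φ ψ =>
    simp only [verifies_imp]
    exact fun y _ h z hz _ => h.mono hz
  | a2 φ ψ γ =>
    simp only [verifies_imp]
    exact fun y _ h z hz h' t ht hφ => h t (hz.trans ht) hφ t le_rfl (h' t ht hφ)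
  | a3 φ ψ => exact verifies_imp.2 fun y _ h => h.1
  | a4 φ ψ => exact verifies_imp.2 fun y _ h => h.2
  | a5 φ ψ γ =>
    simp only [verifies_imp, verifies_and]
    exact fun y _ h z hz h' t ht hφ => ⟨h t (hz.trans ht) hφ, h' t ht hφ⟩
  | a6 φ ψ => exact verifies_imp.2 fun y _ h => Or.inl h
  | a7 φ ψ => exact verifies_imp.2 fun y _ h => Or.inr h
  | a8 φ ψ γ =>
    simp only [verifies_imp, verifies_or]
    exact fun y _ h z hz h' t ht => Or.rec (h t (hz.trans ht)) (h' t ht)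
  | a9 φ => exact verifies_iff fun y => falsifies_neg
  | a10 φ ψ => exact verifies_iff fun y => falsifies_or
  | a11 φ ψ => exact verifies_iff fun y => falsifies_and
  | a12 φ ψ => exact verifies_iff fun y => falsifies_imp
  | a13 φ ψ =>
    simp only [verifies_imp, verifies_neg]
    exact fun y _ h z hz h' => absurd h' (h.mono hz).not_falsifies
  | mp _ _ ih ih' => exact verifies_imp.1 (ih' x) x le_rfl (ih x)

end Soundness

/-! ### Prime theories and the extension lemma -/

section Theories

variable {V : Type u} {T : Set (Formula V)} {φ ψ γ : Formula V}

/-- A set of formulas that contains the theorems of Nelson logic and is closed under modus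
ponens. -/
structure IsTheory (T : Set (Formula V)) : Prop where
  of_provable : ∀ {φ}, Provable φ → φ ∈ T
  mp : ∀ {φ ψ}, φ ∈ T → φ.imp ψ ∈ T → ψ ∈ T

/-- A consistent theory that contains a member of every disjunction it contains. -/
structure IsPrimeTheory (T : Set (Formula V)) : Prop extends IsTheory T where
  consistent : ∀ {φ}, φ ∈ T → φ.neg ∉ T
  prime : ∀ {φ ψ}, φ.or ψ ∈ T → φ ∈ T ∨ ψ ∈ T

theorem isTheory_provable : IsTheory {φ : Formula V | Provable φ} :=
  ⟨id, Provable.mp⟩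

namespace IsTheory

theorem mem_of_provable_imp (hT : IsTheory T) (h : Provable (φ.imp ψ)) (hφ : φ ∈ T) : ψ ∈ T :=
  hT.mp hφ (hT.of_provable h)

theorem imp_mem (hT : IsTheory T) (h : ψ ∈ T) : φ.imp ψ ∈ T :=
  hT.mem_of_provable_imp (.a1 ψ φ) h

theorem imp_self_mem (hT : IsTheory T) : φ.imp φ ∈ T :=
  hT.mp (hT.of_provable (.a1 φ φ)) (hT.mem_of_provable_imp (.a2 φ (φ.imp φ) φ)
    (hT.of_provable (.a1 φ (φ.imp φ))))

theorem and_mem_iff (hT : IsTheory T) : φ.and ψ ∈ T ↔ φ ∈ T ∧ ψ ∈ T := by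
  refine ⟨fun h => ⟨hT.mem_of_provable_imp (.a3 _ _) h, hT.mem_of_provable_imp (.a4 _ _) h⟩,
    fun h => ?_⟩
  exact hT.mp h.1 (hT.mp (hT.imp_mem h.2) (hT.mem_of_provable_imp (.a5 φ φ ψ) hT.imp_self_mem))

theorem mem_iff_of_provable_iff (hT : IsTheory T) (h : Provable (φ.iff ψ)) : φ ∈ T ↔ ψ ∈ T :=
  have h' := hT.and_mem_iff.1 (hT.of_provable h)
  ⟨fun hφ => hT.mp hφ h'.1, fun hψ => hT.mp hψ h'.2⟩

/-- The theory generated by `T` and `φ`. -/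
theorem adjoin (hT : IsTheory T) (φ : Formula V) : IsTheory {χ | φ.imp χ ∈ T} :=
  ⟨fun h => hT.imp_mem (hT.of_provable h),
    fun h h' => hT.mp h (hT.mem_of_provable_imp (.a2 _ _ _) h')⟩

/-- A theory maximal among those omitting `ψ` is prime: any formula outside it implies `ψ` inside
it, so a disjunction of two such formulas would yield `ψ` by `a8`. It is consistent because a
contradiction yields `ψ` by `a13`. -/
theorem exists_isPrimeTheory (hT : IsTheory T) (hψ : ψ ∉ T) :
    ∃ M, IsPrimeTheory M ∧ T ⊆ M ∧ ψ ∉ M := by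
  obtain ⟨M, hTM, hM⟩ := zorn_subset_nonempty {S | IsTheory S ∧ ψ ∉ S} (by
    rintro c hc hch ⟨S₀, hS₀⟩
    refine ⟨⋃₀ c, ⟨⟨fun h => ⟨S₀, hS₀, (hc hS₀).1.of_provable h⟩, ?_⟩, ?_⟩,
      fun S hS => Set.subset_sUnion_of_mem hS⟩
    · rintro χ γ ⟨S, hS, h⟩ ⟨S', hS', h'⟩
      rcases hch.total hS hS' with hle | hle
      · exact ⟨S', hS', (hc hS').1.mp (hle h) h'⟩
      · exact ⟨S, hS, (hc hS).1.mp h (hle h')⟩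
    · rintro ⟨S, hS, h⟩
      exact (hc hS).2 h) T ⟨hT, hψ⟩
  have hMT : IsTheory M := hM.prop.1
  have key : ∀ χ, χ ∉ M → χ.imp ψ ∈ M := by
    intro χ hχ
    by_contra h
    -- If `χ.imp ψ` were missing, adjoining `χ` to `M` would still omit `ψ`; maximality then puts
    -- `χ` in `M`.
    have hle := hM.le_of_ge (y := {γ | χ.imp γ ∈ M}) ⟨hMT.adjoin χ, h⟩
      (fun γ hγ => hMT.imp_mem hγ)
    exact hχ (hle hMT.imp_self_mem)
  refine ⟨M, ⟨hMT, fun {χ} h h' => ?_, fun {χ γ} h => ?_⟩, hTM, hM.prop.2⟩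
  · exact hM.prop.2 (hMT.mp h' (hMT.mem_of_provable_imp (.a13 χ ψ) h))
  · by_contra! hcon
    exact hM.prop.2 (hMT.mp h (hMT.mp (key γ hcon.2)
      (hMT.mem_of_provable_imp (.a8 χ γ ψ) (key χ hcon.1))))

end IsTheory

theorem IsPrimeTheory.or_mem_iff (hT : IsPrimeTheory T) : φ.or ψ ∈ T ↔ φ ∈ T ∨ ψ ∈ T :=
  ⟨hT.prime, Or.rec (hT.mem_of_provable_imp (.a6 _ _)) (hT.mem_of_provable_imp (.a7 _ _))⟩

end Theories

/-! ### Finite filtration of the canonical model, and completeness -/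

section Completeness

variable {V : Type u}

/-- The subformulas of a formula and their strong negations. -/
def Formula.signedSubformulas : Formula V → Set (Formula V)
  | .var p => {.var p, (Formula.var p).neg}
  | .and φ ψ => {φ.and ψ, (φ.and ψ).neg} ∪ (φ.signedSubformulas ∪ ψ.signedSubformulas)
  | .or φ ψ => {φ.or ψ, (φ.or ψ).neg} ∪ (φ.signedSubformulas ∪ ψ.signedSubformulas)
  | .imp φ ψ => {φ.imp ψ, (φ.imp ψ).neg} ∪ (φ.signedSubformulas ∪ ψ.signedSubformulas)
  | .neg φ => {φ.neg, φ.neg.neg} ∪ φ.signedSubformulas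

theorem Formula.finite_signedSubformulas (φ : Formula V) : φ.signedSubformulas.Finite := by
  induction φ with
  | var p => exact Set.toFinite {.var p, (Formula.var p).neg}
  | and φ ψ h h' => exact (Set.toFinite _).union (h.union h')
  | or φ ψ h h' => exact (Set.toFinite _).union (h.union h')
  | imp φ ψ h h' => exact (Set.toFinite _).union (h.union h')
  | neg φ h => exact (Set.toFinite _).union h

theorem Formula.self_mem_signedSubformulas (φ : Formula V) : φ ∈ φ.signedSubformulas := by
  cases φ <;> simp [Formula.signedSubformulas]

/-- A filtration of the canonical model through the set `S` of formulas: the points of `U` are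
labelled by prime theories, compared by their members in `S`; every prime theory agrees on `S`
with a label, and no point is its only successor. -/
structure IsFiltration {U : Type w} [Preorder U] (S : Set (Formula V))
    (T : U → Set (Formula V)) : Prop where
  isPrimeTheory : ∀ x, IsPrimeTheory (T x)
  le_iff : ∀ {x y}, x ≤ y ↔ ∀ φ ∈ S, φ ∈ T x → φ ∈ T y
  exists_agree : ∀ M, IsPrimeTheory M → ∃ y, ∀ φ ∈ S, φ ∈ T y ↔ φ ∈ M
  exists_ne : ∀ x : U, Set.Ici x ≠ {x}

namespace IsFiltration

variable {U : Type w} [Preorder U] {S : Set (Formula V)} {T : U → Set (Formula V)}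

/-- The valuation that verifies or falsifies a variable in `S` where its label asserts or
rejects it. -/
def valuation (h : IsFiltration S T) (p : V) : RoughSet U :=
  RoughSet.mk {x | .var p ∈ S ∧ .var p ∈ T x}
    {x | ¬ ((Formula.var p).neg ∈ S ∧ (Formula.var p).neg ∈ T x)}
    ⟨fun _ _ hxy hx => ⟨hx.1, h.le_iff.1 hxy _ hx.1 hx.2⟩,
      fun _ _ hyx hx hy => hx ⟨hy.1, h.le_iff.1 hyx _ hy.1 hy.2⟩,
      -- Consistency of the label is what keeps the verified and falsified parts disjoint.
      fun x hx hx' => (h.isPrimeTheory x).consistent hx.2 hx'.2,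
      fun x hx => absurd hx (h.exists_ne x)⟩

/-- If the implication is not in `T x`, adjoining `φ` to `T x` leaves `ψ` out, and a prime extension
`M` still omits `ψ`. A point whose label agrees with `M` on `S` lies above `x`, since the order only
compares members of `S`. -/
theorem imp_mem_iff (h : IsFiltration S T) {φ ψ : Formula V} (hφψ : φ.imp ψ ∈ S) (hφ : φ ∈ S)
    (hψ : ψ ∈ S) {x : U} : φ.imp ψ ∈ T x ↔ ∀ y, x ≤ y → φ ∈ T y → ψ ∈ T y := by
  refine ⟨fun hx y hxy hy => (h.isPrimeTheory y).mp hy (h.le_iff.1 hxy _ hφψ hx), fun H => ?_⟩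
  by_contra hx
  have hT := (h.isPrimeTheory x).toIsTheory
  obtain ⟨M, hM, hle, hψM⟩ := (hT.adjoin φ).exists_isPrimeTheory hx
  obtain ⟨y, hy⟩ := h.exists_agree M hM
  refine hψM ((hy ψ hψ).1 (H y (h.le_iff.2 fun χ hχ hχx => ?_) ((hy φ hφ).2 ?_)))
  · exact (hy χ hχ).2 (hle (hT.imp_mem hχx))
  · exact hle hT.imp_self_mem

/-- Both halves are proved together because strong negation swaps them and falsifying an implication
involves verifying its antecedent. -/
theorem verifies_falsifies_iff (h : IsFiltration S T) (φ : Formula V)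
    (hφ : φ.signedSubformulas ⊆ S) (x : U) :
    (Verifies h.valuation x φ ↔ φ ∈ T x) ∧ (Falsifies h.valuation x φ ↔ φ.neg ∈ T x) := by
  induction φ generalizing x with
  | var p =>
    have h1 : Formula.var p ∈ S := hφ (Or.inl rfl)
    have h2 : (Formula.var p).neg ∈ S := hφ (Or.inr rfl)
    exact ⟨and_iff_right h1, not_not.trans (and_iff_right h2)⟩
  | and φ ψ ih ih' =>
    have i := ih (fun _ hχ => hφ (Or.inr (Or.inl hχ)))
    have i' := ih' (fun _ hχ => hφ (Or.inr (Or.inr hχ)))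
    have hT := h.isPrimeTheory x
    rw [verifies_and, falsifies_and, (i x).1, (i' x).1, (i x).2, (i' x).2, hT.and_mem_iff,
      hT.mem_iff_of_provable_iff (.a11 φ ψ), hT.or_mem_iff]
    exact ⟨Iff.rfl, Iff.rfl⟩
  | or φ ψ ih ih' =>
    have i := ih (fun _ hχ => hφ (Or.inr (Or.inl hχ)))
    have i' := ih' (fun _ hχ => hφ (Or.inr (Or.inr hχ)))
    have hT := h.isPrimeTheory x
    rw [verifies_or, falsifies_or, (i x).1, (i' x).1, (i x).2, (i' x).2, hT.or_mem_iff,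
      hT.mem_iff_of_provable_iff (.a10 φ ψ), hT.and_mem_iff]
    exact ⟨Iff.rfl, Iff.rfl⟩
  | imp φ ψ ih ih' =>
    have s : φ.signedSubformulas ⊆ S := fun _ hχ => hφ (Or.inr (Or.inl hχ))
    have s' : ψ.signedSubformulas ⊆ S := fun _ hχ => hφ (Or.inr (Or.inr hχ))
    have i := ih s
    have i' := ih' s'
    have hT := h.isPrimeTheory x
    rw [verifies_imp, falsifies_imp, (i x).1, (i' x).2,
      hT.mem_iff_of_provable_iff (.a12 φ ψ), hT.and_mem_iff,
      h.imp_mem_iff (hφ (Or.inl (Or.inl rfl))) (s φ.self_mem_signedSubformulas)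
        (s' ψ.self_mem_signedSubformulas)]
    simp only [fun y => (i y).1, fun y => (i' y).1, and_self]
  | neg φ ih =>
    have i := ih (fun _ hχ => hφ (Or.inr hχ)) x
    rw [verifies_neg, falsifies_neg, i.1, i.2,
      (h.isPrimeTheory x).mem_iff_of_provable_iff (.a9 φ)]
    exact ⟨Iff.rfl, Iff.rfl⟩

end IsFiltration

/-- The points are doubled so that none of them is its only successor. -/
theorem exists_isFiltration {S : Set (Formula V)} (hS : S.Finite) :
    ∃ (U : Type w) (_ : Preorder U) (_ : Finite U) (T : U → Set (Formula V)),
      IsFiltration S T := by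
  let R : Set (Set (Formula V)) := {A | ∃ M, IsPrimeTheory M ∧ A = M ∩ S}
  have hR : R.Finite := hS.finite_subsets.subset (by
    rintro _ ⟨M, _, rfl⟩
    exact Set.inter_subset_right)
  have : Finite R := hR
  obtain ⟨n, ⟨e₀⟩⟩ := Finite.exists_equiv_fin (R × Bool)
  -- The traces live in the universe of the formulas; finiteness allows a copy of the doubled set in
  -- `Type w`.
  obtain ⟨U, hU, ⟨e⟩⟩ : ∃ U : Type w, Finite U ∧ Nonempty (U ≃ R × Bool) :=
    ⟨ULift.{w} (Fin n), inferInstance, ⟨Equiv.ulift.trans e₀.symm⟩⟩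
  choose L hL hLS using fun A : R => A.2
  let T : U → Set (Formula V) := fun x => L (e x).1
  let _ : Preorder U := Preorder.lift fun x => T x ∩ S
  have hle : ∀ {x y : U}, x ≤ y ↔ ∀ φ ∈ S, φ ∈ T x → φ ∈ T y :=
    ⟨fun h φ hφ hx => (h ⟨hx, hφ⟩).1, fun h φ hφ => ⟨h φ hφ.2 hφ.1, hφ.2⟩⟩
  refine ⟨U, inferInstance, hU, T, fun x => hL _, hle, fun M hM => ?_, fun x hx => ?_⟩
  · refine ⟨e.symm (⟨M ∩ S, M, hM, rfl⟩, true), fun φ hφ => ?_⟩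
    have hM' := Set.ext_iff.1 (hLS ⟨M ∩ S, M, hM, rfl⟩) φ
    simp only [Set.mem_inter_iff, hφ, and_true] at hM'
    simp only [T, Equiv.apply_symm_apply]
    exact hM'.symm
  -- The twin of `x` has the same label, hence is a successor of `x`, but differs in the Boolean
  -- coordinate.
  · have hmem : e.symm ((e x).1, !(e x).2) ∈ Set.Ici x :=
      hle.2 fun φ _ hφ => by simpa only [T, Equiv.apply_symm_apply] using hφ
    rw [hx, Set.mem_singleton_iff, Equiv.symm_apply_eq, Prod.ext_iff] at hmem
    exact Bool.not_ne_self _ hmem.2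

end Completeness

end NelsonLogic

theorem mainTheorem2 {V : Type u} (α : NelsonLogic.Formula V) :
    NelsonLogic.Provable α ↔
      ∀ (U : Type w) [Preorder U] [Finite (NelsonLogic.RoughSet U)],
        α.Valid (NelsonLogic.RoughSet U) := by

  open NelsonLogic in
  refine ⟨fun h U _ _ v => RoughSet.eq_top_iff.2 fun x => h.verifies x, fun H => ?_⟩
  by_contra hα
  obtain ⟨U, _, _, T, hT⟩ := exists_isFiltration.{u, w} α.finite_signedSubformulas
  obtain ⟨M, hM, -, hαM⟩ := isTheory_provable.exists_isPrimeTheory hα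
  obtain ⟨y, hy⟩ := hT.exists_agree M hM
  have : Finite (RoughSet U) := Subtype.finite
  have hv : Verifies hT.valuation y α := RoughSet.eq_top_iff.1 (H U hT.valuation) y
  exact hαM ((hy α α.self_mem_signedSubformulas).1
    ((hT.verifies_falsifies_iff α subset_rfl y).1.1 hv))
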